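/- **Language.** A program is a finite sequence of statements labelled by line numbers: `skip`, assignment $x:=e$, field update $x.f:=e$, `read` $x$, `write` $x_1,\dots,x_k$, conditionals and `while` loops with side-effect free guards. Variables and fields are typed as integer or reference (a reference is a heap location or null). A memory $\mu$ consists of a store, which maps variables to values, and a heap, which maps locations to objects, i.e. to maps from fields to values. Expressions are built from constants, variables, arbitrary total integer operators and field accesses, and their evaluation is total (a field read through null gives a default value, a field update through null has no effect); `read` $x$ sets $x$ to its value in the input memory. The state trajectory $\tau_P^{\mu}$ of $P$ from the input memory $\mu$ is the sequence of the states $\langle n^k,\mu'\rangle$ of the execution: line $n$ is executed for the $k$-th time, in the memory $\mu'$. **Slices.** A slicing criterion is $C=(\mathcal I,\mathcal X,\mathcal O,\psi)$ with a set $\mathcal I$ of input memories, a set $\mathcal X$ of variables, a set $\mathcal O$ of pairs $\langle n,K\rangle$ ($n$ a line number, $K\subseteq\mathbb N$) and a truth value $\psi$. For a set $\mathcal L$ of lines, $\mathrm{Proj}_{(\mathcal X,\mathcal O,\mathcal L)}$ maps a trajectory to the sequence in which each state $\langle n^k,\mu'\rangle$ is replaced by $\langle n^k,\mu'|_{\mathcal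 X}\rangle$ if $k\in K$ for some $\langle n,K\rangle\in\mathcal O$, otherwise by $\langle n^k,\bot\rangle$ if $n\in\mathcal L$, and otherwise is deleted. A program $Q$ is a slice of $P$ w.r.t. $C$ if $Q$ is obtained from $P$ by removing zero or more statements and, with $\mathcal L$ the set of lines common to $P$ and $Q$ if $\psi$ is true and $\mathcal L=\emptyset$ otherwise, for every $\mu\in\mathcal I$: (i) if $P$ halts on $\mu$, then so does $Q$, and $\mathrm{Proj}_{(\mathcal X,\mathcal O,\mathcal L)}(\tau_P^\mu)=\mathrm{Proj}_{(\mathcal X,\mathcal O,\mathcal L)}(\tau_Q^\mu)$; (ii) whether or not $P$ halts on $\mu$, every finite initial part of the execution of $P$ on $\mu$ has the same projection as some finite initial part of the execution of $Q$ on $\mu$. **Semantic PDG.** Let a cell be a variable or the content of a field $f$ (over all objects). An expression $e$ semantically depends on a cell $c$ if there are two memories that agree on all other cells and on which $e$ has different values. The nodes of the semantic program dependence graph $\mathcal G^s_P$ are an entry node and the lines of $P$. Its control dependency edges $u\to v$ are those where $u$ is the entry node and $v$ is not nested within any control predicate, or $u$ is a control predicate and $v$ is immediately nested within it. Its semantic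 flow edges $u\to v$ are those for which there is a cell $c$ such that (1) $u$ defines $c$ (assignment to or `read` of the variable, resp. update of the field); (2) $v$ contains an expression that semantically depends on $c$, where the observation made by the criterion counts as such an expression, i.e. this also holds if $\langle v,K\rangle\in\mathcal O$ for some $K$ and $c\in\mathcal X$; (3) control can reach $v$ from $u$ along a path of the control flow graph without intervening redefinition of $c$ (a field update does not redefine the field, as it leaves all other objects unchanged). **Theorem.** Let $C=(\mathcal I,\mathcal X,\mathcal O,\psi)$ be a slicing criterion, let $P$ be a program and let $\mathcal N_{\mathcal O}=\{n\mid \exists K,\ \langle n,K\rangle\in\mathcal O\}$. Let $Q$ be the subprogram of $P$ that contains exactly the statements of $P$ whose node has a (possibly empty) path in $\mathcal G^s_P$, along control and semantic flow edges, to a node in $\mathcal N_{\mathcal O}$. Then the lines of $Q$ are exactly these nodes, and $Q$ is a slice of $P$ w.r.t. $C$. -/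

import Mathlib

namespace Slicing

/-! ## The programming language -/

/-- The types of variables and fields: integers and references. -/
inductive Ty where
  | int
  | ref
  deriving DecidableEq

/-- The values of a type. A reference is a heap location or `null` (which is `none`). -/
def Ty.Val : Ty → Type
  | .int => ℤ
  | .ref => Option ℕ

instance (t : Ty) : DecidableEq t.Val :=
  match t with
  | .int => inferInstanceAs (DecidableEq ℤ)
  | .ref => inferInstanceAs (DecidableEq (Option ℕ))

def Ty.default : (t : Ty) → t.Val
  | .int => (0 : ℤ)
  | .ref => (none : Option ℕ)

/-- Program variables; every variable is well-typed. -/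
structure Var where
  ty : Ty
  name : ℕ
  deriving DecidableEq

/-- Field identifiers. -/
structure Field where
  ty : Ty
  name : ℕ
  deriving DecidableEq

/-- A store maps variables to values. -/
abbrev Store := (x : Var) → x.ty.Val

/-- An object maps field identifiers to values. -/
abbrev Obj := (f : Field) → f.ty.Val

/-- A memory is a store and a heap (which maps locations to objects). -/
structure Mem where
  store : Store
  heap : ℕ → Obj

/-- Side-effect free expressions; the binary integer operators are arbitrary total functions, and
`get e f` is the field access `e.f`. -/
inductive Exp : Ty → Type where
  | num (z : ℤ) : Exp .int
  | null : Exp .ref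
  | var (t : Ty) (x : ℕ) : Exp t
  | op (f : ℤ → ℤ → ℤ) (a b : Exp .int) : Exp .int
  | get (t : Ty) (e : Exp .ref) (f : ℕ) : Exp t

/-- The value of field `f` of the object that the reference `r` points to. -/
def Mem.read (m : Mem) (r : Option ℕ) (f : Field) : f.ty.Val :=
  match r with
  | none => f.ty.default
  | some l => m.heap l f

/-- Evaluation of expressions (total; reading a field of `null` gives the default value). -/
def Exp.eval (m : Mem) : {t : Ty} → Exp t → t.Val
  | _, .num z => z
  | _, .null => (none : Option ℕ)
  | _, .var t x => m.store ⟨t, x⟩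
  | _, .op f a b => f (a.eval m) (b.eval m)
  | _, .get t e f => m.read (e.eval m) ⟨t, f⟩

/-- Boolean guards. -/
inductive Guard where
  | rel (r : ℤ → ℤ → Bool) (a b : Exp .int)
  | refEq (a b : Exp .ref)
  | conn (c : Bool → Bool → Bool) (a b : Guard)

def Guard.eval (m : Mem) : Guard → Bool
  | .rel r a b => r (a.eval m) (b.eval m)
  | .refEq a b => decide (a.eval m = b.eval m)
  | .conn c a b => c (a.eval m) (b.eval m)

/-- Simple statements. In `fassign x f e`, which is `x.f := e`, the number `x` is the name of a
variable of reference type. -/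
inductive Simple where
  | skip
  | assign (x : Var) (e : Exp x.ty)
  | fassign (x : ℕ) (f : Field) (e : Exp f.ty)
  | read (x : Var)
  | write (xs : List Var)

def Mem.setVar (m : Mem) (x : Var) (v : x.ty.Val) : Mem :=
  { m with store := Function.update m.store x v }

/-- Update of field `f` of the object that `r` points to; there is no effect if `r` is `null`. -/
def Mem.setField (m : Mem) (r : Option ℕ) (f : Field) (v : f.ty.Val) : Mem :=
  match r with
  | none => m
  | some l => { m with heap := Function.update m.heap l (Function.update (m.heap l) f v) }

/-- The effect of a simple statement in a run with input memory `inp`: `read x` gives `x` its input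
value, and `write` only produces output. -/
def Simple.exec (inp m : Mem) : Simple → Mem
  | .skip => m
  | .assign x e => m.setVar x (e.eval m)
  | .fassign x f e => m.setField (m.store ⟨.ref, x⟩) f (e.eval m)
  | .read x => m.setVar x (inp.store x)
  | .write _ => m

/-- Programs are sequences of statements that are labelled by line numbers. The argument `rest` is
the part of the sequence that follows the first statement. -/
inductive Prog where
  | nil
  | simple (n : ℕ) (a : Simple) (rest : Prog)
  | ite (n : ℕ) (g : Guard) (c₁ c₂ : Prog) (rest : Prog)
  | loop (n : ℕ) (g : Guard) (c : Prog) (rest : Prog)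

namespace Prog

/-- Sequential composition. -/
def append : Prog → Prog → Prog
  | nil, Q => Q
  | simple n a r, Q => simple n a (r.append Q)
  | ite n g c₁ c₂ r, Q => ite n g c₁ c₂ (r.append Q)
  | loop n g c r, Q => loop n g c (r.append Q)

/-- The line numbers of all the statements of a program. -/
def lines : Prog → Set ℕ
  | nil => ∅
  | simple n _ r => {n} ∪ r.lines
  | ite n _ c₁ c₂ r => {n} ∪ c₁.lines ∪ c₂.lines ∪ r.lines
  | loop n _ c r => {n} ∪ c.lines ∪ r.lines

/-- The line numbers of the statements that are not nested within a control predicate. -/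
def topLines : Prog → Set ℕ
  | nil => ∅
  | simple n _ r => {n} ∪ r.topLines
  | ite n _ _ _ r => {n} ∪ r.topLines
  | loop n _ _ r => {n} ∪ r.topLines

/-- `P.Nested u v`: line `u` of `P` is a control predicate, and line `v` is immediately nested
within it. -/
def Nested : Prog → ℕ → ℕ → Prop
  | nil, _, _ => False
  | simple _ _ r, u, v => r.Nested u v
  | ite n _ c₁ c₂ r, u, v => (u = n ∧ (v ∈ c₁.topLines ∨ v ∈ c₂.topLines)) ∨
      c₁.Nested u v ∨ c₂.Nested u v ∨ r.Nested u v
  | loop n _ c r, u, v => (u = n ∧ v ∈ c.topLines) ∨ c.Nested u v ∨ r.Nested u v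

/-- `Q.Sub P`, that is `Q ⊑ P`: the program `Q` is obtained from `P` by removing zero or more
statements, without changing line numbers. -/
inductive Sub : Prog → Prog → Prop where
  | nil : Sub nil nil
  | simple {n a q p} : Sub q p → Sub (simple n a q) (simple n a p)
  | ite {n g d₁ c₁ d₂ c₂ q p} : Sub d₁ c₁ → Sub d₂ c₂ → Sub q p →
      Sub (ite n g d₁ d₂ q) (ite n g c₁ c₂ p)
  | loop {n g d c q p} : Sub d c → Sub q p → Sub (loop n g d q) (loop n g c p)
  | dropSimple {n a q p} : Sub q p → Sub q (simple n a p)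
  | dropIte {n g c₁ c₂ q p} : Sub q p → Sub q (ite n g c₁ c₂ p)
  | dropLoop {n g c q p} : Sub q p → Sub q (loop n g c p)

open Classical in
/-- The subprogram of the statements whose line number is in `S` (a conditional or a loop whose
line number is not in `S` is removed together with everything nested in it). -/
noncomputable def restrict (S : Set ℕ) : Prog → Prog
  | nil => nil
  | simple n a r => if n ∈ S then simple n a (r.restrict S) else r.restrict S
  | ite n g c₁ c₂ r =>
      if n ∈ S then ite n g (c₁.restrict S) (c₂.restrict S) (r.restrict S) else r.restrict S
  | loop n g c r => if n ∈ S then loop n g (c.restrict S) (r.restrict S) else r.restrict S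

end Prog

/-! ## Executions and trajectories -/

/-- `Run inp P m t R m'`: in a run with input memory `inp`, the program `P`, started in memory `m`,
executes in turn the line numbers in `t` (each one paired with the memory in which it is executed);
after that the memory is `m'` and the program `R` is still to be executed. -/
inductive Run (inp : Mem) : Prog → Mem → List (ℕ × Mem) → Prog → Mem → Prop where
  | refl (P : Prog) (m : Mem) : Run inp P m [] P m
  | simple {n a r m t R m'} : Run inp r (a.exec inp m) t R m' →
      Run inp (.simple n a r) m ((n, m) :: t) R m'
  | ite {n g c₁ c₂ r m t R m'} :
      Run inp ((if g.eval m then c₁ else c₂).append r) m t R m' →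
      Run inp (.ite n g c₁ c₂ r) m ((n, m) :: t) R m'
  | loop {n g c r m t R m'} :
      Run inp (if g.eval m then c.append (.loop n g c r) else r) m t R m' →
      Run inp (.loop n g c r) m ((n, m) :: t) R m'

/-- A program state `⟨n^k, μ⟩`: the program point `n` is executed for the `k`-th time, in
memory `μ`. -/
structure State where
  point : ℕ
  iter : ℕ
  mem : Mem

/-- Equips the states of a trace with their iteration counters; `c n` is the number of times that
the point `n` has been reached before. -/
def count (c : ℕ → ℕ) : List (ℕ × Mem) → List State
  | [] => []
  | (n, m) :: t => ⟨n, c n + 1, m⟩ :: count (Function.update c n (c n + 1)) t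

/-- `τ` is the state trajectory of `P` from the input memory `μ`: the sequence of all states of
the execution, which halts. -/
def IsTrajectory (P : Prog) (μ : Mem) (τ : List State) : Prop :=
  ∃ t m', Run μ P μ t .nil m' ∧ τ = count (fun _ => 0) t

/-- `τ` is a finite initial part of the (possibly infinite) state trajectory of `P` from the input
memory `μ`. -/
def IsTrajectoryPrefix (P : Prog) (μ : Mem) (τ : List State) : Prop :=
  ∃ t R m', Run μ P μ t R m' ∧ τ = count (fun _ => 0) t

/-! ## Slicing criteria and slices -/

/-- A slicing criterion `(I, X, O, ψ)`. -/
structure Criterion where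
  inputs : Set Mem
  vars : Set Var
  occs : Set (ℕ × Set ℕ)
  kl : Prop

/-- The program points of the criterion. -/
def Criterion.points (C : Criterion) : Set ℕ :=
  {n | ∃ K, (n, K) ∈ C.occs}

/-- A projected state: a restricted memory is a function on `X`, and `none` stands for `⊥`. -/
structure ProjState (X : Set Var) where
  point : ℕ
  iter : ℕ
  obs : Option ((x : X) → x.1.ty.Val)

open Classical in
/-- Projection of a single state (`none` is the empty sequence). -/
noncomputable def projState (X : Set Var) (O : Set (ℕ × Set ℕ)) (L : Set ℕ) (s : State) :
    Option (ProjState X) :=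
  if ∃ K, (s.point, K) ∈ O ∧ s.iter ∈ K then
    some ⟨s.point, s.iter, some fun x => s.mem.store x.1⟩
  else if s.point ∈ L then some ⟨s.point, s.iter, none⟩
  else none

/-- Trajectory projection. -/
noncomputable def proj (X : Set Var) (O : Set (ℕ × Set ℕ)) (L : Set ℕ) (τ : List State) :
    List (ProjState X) :=
  τ.filterMap (projState X O L)

/-- The program points that both programs have to execute in the same order: the common ones in
the Korel-Laski forms of slicing, none otherwise. -/
def Criterion.common (C : Criterion) (P Q : Prog) : Set ℕ :=
  {n | C.kl ∧ n ∈ P.lines ∧ n ∈ Q.lines}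

/-- Equivalence of `P` and `Q` with respect to the criterion, on all inputs of the criterion: if
`P` halts, then so does `Q`, and the two trajectories have the same projection; whether `P` halts
or not, the observations along any finite part of the execution of `P` are made, in the same order
and with the same values, by `Q`. -/
def Criterion.Equivalent (C : Criterion) (P Q : Prog) : Prop :=
  ∀ μ ∈ C.inputs,
    (∀ τ, IsTrajectory P μ τ → ∃ τ', IsTrajectory Q μ τ' ∧
      proj C.vars C.occs (C.common P Q) τ = proj C.vars C.occs (C.common P Q) τ') ∧
    (∀ τ, IsTrajectoryPrefix P μ τ → ∃ τ', IsTrajectoryPrefix Q μ τ' ∧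
      proj C.vars C.occs (C.common P Q) τ = proj C.vars C.occs (C.common P Q) τ')

/-- `Q` is a slice of `P` with respect to the criterion `C`. -/
def IsSlice (C : Criterion) (P Q : Prog) : Prop :=
  Q.Sub P ∧ C.Equivalent P Q

/-! ## Semantic dependencies and the semantic program dependence graph -/

/-- The components of a memory on which an expression may depend: the variables, and the contents
of each field (over all objects). -/
inductive Cell where
  | var (x : Var)
  | field (f : Field)

/-- Two memories agree on everything except possibly `c`. -/
def Mem.AgreeOff (c : Cell) (m₁ m₂ : Mem) : Prop :=
  (∀ y, c ≠ .var y → m₁.store y = m₂.store y) ∧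
  (∀ f, c ≠ .field f → ∀ l, m₁.heap l f = m₂.heap l f)

/-- Semantic dependency on `c` of an expression with evaluation function `ev`. -/
def SemDep {α : Type} (c : Cell) (ev : Mem → α) : Prop :=
  ∃ m₁ m₂, m₁.AgreeOff c m₂ ∧ ev m₁ ≠ ev m₂

/-- The statement proper at a program point: a simple statement or a control predicate. -/
inductive Comp where
  | simple (a : Simple)
  | guard (g : Guard)

/-- The component defines `c`. -/
def Comp.Defines (c : Cell) : Comp → Prop
  | .simple (.assign x _) => c = .var x
  | .simple (.read x) => c = .var x
  | .simple (.fassign _ f _) => c = .field f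
  | _ => False

/-- The component overwrites `c`. A field update does not: it leaves the field of all other objects
as it was. -/
def Comp.Redefines (c : Cell) : Comp → Prop
  | .simple (.assign x _) => c = .var x
  | .simple (.read x) => c = .var x
  | _ => False

/-- The component contains an expression that semantically depends on `c`. -/
def Comp.DependsOn (c : Cell) : Comp → Prop
  | .simple .skip => False
  | .simple (.assign _ e) => SemDep c fun m => e.eval m
  | .simple (.fassign x _ e) =>
      SemDep c (fun m => (Exp.var .ref x).eval m) ∨ SemDep c fun m => e.eval m
  | .simple (.read _) => False
  | .simple (.write xs) => ∃ x ∈ xs, SemDep c fun m => m.store x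
  | .guard g => SemDep c fun m => g.eval m

/-- The criterion observes `c` at the program point `n`. -/
def Criterion.Observes (C : Criterion) (n : ℕ) (c : Cell) : Prop :=
  n ∈ C.points ∧ ∃ x ∈ C.vars, c = .var x

namespace Prog

/-- The statement that a program executes first, with its line number. -/
def head? : Prog → Option (ℕ × Comp)
  | nil => none
  | simple n a _ => some (n, .simple a)
  | ite n g _ _ _ => some (n, .guard g)
  | loop n g _ _ => some (n, .guard g)

/-- One step of control, with either outcome of a guard. The position of control in a program is
given by the program that is still to be executed. -/
inductive Ctl : Prog → Prog → Prop where
  | simple {n a r} : Ctl (simple n a r) r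
  | iteTrue {n g c₁ c₂ r} : Ctl (ite n g c₁ c₂ r) (c₁.append r)
  | iteFalse {n g c₁ c₂ r} : Ctl (ite n g c₁ c₂ r) (c₂.append r)
  | loopTrue {n g c r} : Ctl (loop n g c r) (c.append (loop n g c r))
  | loopFalse {n g c r} : Ctl (loop n g c r) r

/-- A step of control that does not redefine `c`. -/
def CtlKeeping (c : Cell) (K K' : Prog) : Prop :=
  Ctl K K' ∧ ∀ n s, K.head? = some (n, s) → ¬ s.Redefines c

/-- Semantic flow dependency edges from `u` to `v`: for some `c`, the node `u` defines `c`, the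
node `v` contains an expression that semantically depends on `c` (an observation that the criterion
makes at `v` counts as one), and control can reach `v` from `u` along a path without an
intervening redefinition of `c`. -/
def SemFlow (C : Criterion) (P : Prog) (u v : ℕ) : Prop :=
  ∃ (c : Cell) (K K₁ K₂ : Prog) (su sv : Comp),
    Relation.ReflTransGen Ctl P K ∧ K.head? = some (u, su) ∧ su.Defines c ∧
    Ctl K K₁ ∧ Relation.ReflTransGen (CtlKeeping c) K₁ K₂ ∧
    K₂.head? = some (v, sv) ∧ (sv.DependsOn c ∨ C.Observes v c)

end Prog

/-- The nodes of a program dependence graph: the entry node and the program points. -/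
inductive Node where
  | entry
  | point (n : ℕ)

/-- The edges of the semantic program dependence graph of `P`: the control dependency edges and
the semantic flow dependency edges. -/
inductive SemPDG (C : Criterion) (P : Prog) : Node → Node → Prop where
  | entry {v} : v ∈ P.topLines → SemPDG C P .entry (.point v)
  | control {u v} : P.Nested u v → SemPDG C P (.point u) (.point v)
  | flow {u v} : P.SemFlow C u v → SemPDG C P (.point u) (.point v)

/-- The program points of `P` from which there is a path in the semantic program dependence graph
to a program point of the criterion. -/
def sliceLines (C : Criterion) (P : Prog) : Set ℕ :=
  {u | u ∈ P.lines ∧ ∃ n ∈ C.points, Relation.ReflTransGen (SemPDG C P) (.point u) (.point n)}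

end Slicing

open Slicing

open Slicing

namespace Slicing

/-! ## Memories that agree on a cell, and semantic dependency -/

/-! An execution of `P` is simulated by its restriction to the slice set `S`, keeping the two
memories equal on the relevant (live) cells: those that a line of `S` may use or observe before they
are redefined. This is the induction on runs in `Run.restrict`. At a line in `S`, everything used or
observed is relevant, so guards take the same branch and the agreement survives
(`Simple.exec_congr`). At a line outside `S`, a cell defined there cannot be relevant afterwards,
since a flow edge into `S` would put the line in `S` (`SliceClosed.not_relevant`). A dropped
predicate takes its whole body with it, by closure under control edges (`restrict_eq_nil`). That
agreement on semantic dependencies determines values is a separate fact, `eq_of_agreeOn_semDep`.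
Nontermination is harmless because only executions of `P` have to be matched: a dropped loop that
diverges in `P` is simply absent from the slice. -/

/-- Two memories agree on the cell `c`. -/
def Mem.AgreeOn (m₁ m₂ : Mem) : Cell → Prop
  | .var x => m₁.store x = m₂.store x
  | .field f => ∀ l, m₁.heap l f = m₂.heap l f

/-- The memory `m`, with the contents of the cell `c` taken from `m'`. -/
def Mem.withCell (m m' : Mem) : Cell → Mem
  | .var x => { m with store := Function.update m.store x (m'.store x) }
  | .field f => { m with heap := fun l => Function.update (m.heap l) f (m'.heap l f) }

theorem Mem.agreeOff_withCell (m m' : Mem) (c : Cell) : m.AgreeOff c (m.withCell m' c) := by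
  cases c with
  | var x =>
    refine ⟨fun y hy => ?_, fun _ _ _ => rfl⟩
    have : y ≠ x := fun h => hy (h ▸ rfl)
    simp [withCell, this]
  | field f =>
    refine ⟨fun _ _ => rfl, fun g hg l => ?_⟩
    have : g ≠ f := fun h => hg (h ▸ rfl)
    simp [withCell, this]

theorem Mem.agreeOn_withCell_self (m m' : Mem) (c : Cell) : (m.withCell m' c).AgreeOn m' c := by
  cases c <;> simp [AgreeOn, withCell]

/-- Copying cells from the target memory one at a time never undoes earlier progress. -/
theorem Mem.AgreeOn.withCell {m m' : Mem} {d : Cell} (h : m.AgreeOn m' d) (c : Cell) :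
    (m.withCell m' c).AgreeOn m' d := by
  by_cases hcd : c = d
  · exact hcd ▸ m.agreeOn_withCell_self m' c
  · have hoff := m.agreeOff_withCell m' c
    cases d with
    | var y => exact (hoff.1 y hcd).symm.trans h
    | field f => exact fun l => (hoff.2 f hcd l).symm.trans (h l)

theorem Mem.AgreeOn.withCell_eq {m m' : Mem} {c : Cell} (h : m.AgreeOn m' c) :
    m.withCell m' c = m := by
  cases c with
  | var x =>
    have h : m.store x = m'.store x := h
    simp [Mem.withCell, ← h]
  | field f =>
    have h : ∀ l, m.heap l f = m'.heap l f := h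
    simp [Mem.withCell, ← h]

/-- A function of the memory that is determined by finitely many cells is determined by the cells
on which it semantically depends. -/
theorem eq_of_agreeOn_semDep {α : Type} {ev : Mem → α} {cs : List Cell}
    (hcs : ∀ m₁ m₂ : Mem, (∀ c ∈ cs, m₁.AgreeOn m₂ c) → ev m₁ = ev m₂) {m₁ m₂ : Mem}
    (h : ∀ c, SemDep c ev → m₁.AgreeOn m₂ c) : ev m₁ = ev m₂ := by
  -- Move from `m₁` towards `m₂` cell by cell. Finiteness of the list matters: semantic dependency
  -- only tests changes of a single cell.
  have key : ∀ ds : List Cell, ∃ m : Mem, ev m₁ = ev m ∧ (∀ c ∈ ds, m.AgreeOn m₂ c) ∧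
      ∀ c, SemDep c ev → m.AgreeOn m₂ c := by
    intro ds
    induction ds with
    | nil => exact ⟨m₁, rfl, by simp, h⟩
    | cons d ds ih =>
      obtain ⟨m, hev, hds, hdep⟩ := ih
      refine ⟨m.withCell m₂ d, ?_, ?_, fun c hc => (hdep c hc).withCell d⟩
      -- If copying `d` changed the value, `ev` would depend on `d`; but then the memories already
      -- agree on `d` and copying it does nothing.
      · by_contra hne
        rw [hev] at hne
        have hd : SemDep d ev := ⟨_, _, m.agreeOff_withCell m₂ d, hne⟩
        exact hne (by rw [(hdep d hd).withCell_eq])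
      · intro c hc
        rcases List.mem_cons.1 hc with rfl | hc
        · exact m.agreeOn_withCell_self m₂ _
        · exact (hds c hc).withCell d
  obtain ⟨m, hev, hm, -⟩ := key cs
  exact hev.trans (hcs m m₂ hm)

theorem Mem.read_congr {m₁ m₂ : Mem} {f : Field} (h : m₁.AgreeOn m₂ (.field f))
    (r : Option ℕ) : m₁.read r f = m₂.read r f := by
  cases r with
  | none => rfl
  | some l => exact h l

/-- The cells that occur in an expression. -/
def Exp.cells : {t : Ty} → Exp t → List Cell
  | _, .num _ => []
  | _, .null => []
  | _, .var t x => [.var ⟨t, x⟩]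
  | _, .op _ a b => a.cells ++ b.cells
  | _, .get t e f => .field ⟨t, f⟩ :: e.cells

theorem Exp.eval_congr_cells {t : Ty} (e : Exp t) (m₁ m₂ : Mem)
    (h : ∀ c ∈ e.cells, m₁.AgreeOn m₂ c) : e.eval m₁ = e.eval m₂ := by
  induction e with
  | num z => rfl
  | null => rfl
  | var t x => exact h _ (List.mem_singleton.2 rfl)
  | op f a b iha ihb =>
    simp only [cells, List.mem_append] at h
    exact congrArg₂ f (iha fun c hc => h c (.inl hc)) (ihb fun c hc => h c (.inr hc))
  | get t e f ih =>
    simp only [cells, List.mem_cons] at h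
    simp only [eval, ih fun c hc => h c (.inr hc)]
    exact Mem.read_congr (h _ (.inl rfl)) _

/-- The cells that occur in a guard. -/
def Guard.cells : Guard → List Cell
  | .rel _ a b => a.cells ++ b.cells
  | .refEq a b => a.cells ++ b.cells
  | .conn _ a b => a.cells ++ b.cells

theorem Guard.eval_congr_cells (g : Guard) (m₁ m₂ : Mem)
    (h : ∀ c ∈ g.cells, m₁.AgreeOn m₂ c) : g.eval m₁ = g.eval m₂ := by
  induction g with
  | rel r a b =>
    simp only [cells, List.mem_append] at h
    simp only [eval, a.eval_congr_cells m₁ m₂ fun c hc => h c (.inl hc),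
      b.eval_congr_cells m₁ m₂ fun c hc => h c (.inr hc)]
  | refEq a b =>
    simp only [cells, List.mem_append] at h
    simp only [eval, a.eval_congr_cells m₁ m₂ fun c hc => h c (.inl hc),
      b.eval_congr_cells m₁ m₂ fun c hc => h c (.inr hc)]
  | conn k a b iha ihb =>
    simp only [cells, List.mem_append] at h
    simp only [eval, iha fun c hc => h c (.inl hc), ihb fun c hc => h c (.inr hc)]

theorem Exp.eval_congr {t : Ty} {e : Exp t} {m₁ m₂ : Mem}
    (h : ∀ c, SemDep c (fun m => e.eval m) → m₁.AgreeOn m₂ c) : e.eval m₁ = e.eval m₂ :=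
  eq_of_agreeOn_semDep (ev := fun m => e.eval m) e.eval_congr_cells h

theorem Guard.eval_congr {g : Guard} {m₁ m₂ : Mem}
    (h : ∀ c, SemDep c (fun m => g.eval m) → m₁.AgreeOn m₂ c) : g.eval m₁ = g.eval m₂ :=
  eq_of_agreeOn_semDep (ev := fun m => g.eval m) g.eval_congr_cells h

/-! ## The effect of simple statements on cells -/

theorem Mem.setField_heap_of_ne (m : Mem) (r : Option ℕ) {f g : Field} (hg : g ≠ f)
    (v : f.ty.Val) (l : ℕ) : (m.setField r f v).heap l g = m.heap l g := by
  cases r with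
  | none => rfl
  | some k =>
    by_cases hl : l = k
    · subst hl; simp [setField, hg]
    · simp [setField, hl]

theorem Mem.setField_store (m : Mem) (r : Option ℕ) (f : Field) (v : f.ty.Val) :
    (m.setField r f v).store = m.store := by
  cases r <;> rfl

/-- The same slot receives the same value on both sides, and all other slots are untouched. -/
theorem Mem.AgreeOn.setField {m₁ m₂ : Mem} {c : Cell} (h : m₁.AgreeOn m₂ c) (r : Option ℕ)
    (f : Field) (v : f.ty.Val) : (m₁.setField r f v).AgreeOn (m₂.setField r f v) c := by
  cases c with
  | var y => simpa only [AgreeOn, setField_store] using h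
  | field g =>
    intro l
    by_cases hg : g = f
    · subst hg
      cases r with
      | none => exact h l
      | some k =>
        by_cases hl : l = k
        · subst hl; simp [Mem.setField]
        · simpa [Mem.setField, hl] using h l
    · simpa only [setField_heap_of_ne _ _ hg] using h l

/-- A simple statement changes only cells that it defines. -/
theorem Simple.exec_agreeOn (inp m : Mem) {a : Simple} {c : Cell}
    (h : ¬ (Comp.simple a).Defines c) : (a.exec inp m).AgreeOn m c := by
  cases a with
  | skip => cases c <;> simp [exec, Mem.AgreeOn]
  | write xs => cases c <;> simp [exec, Mem.AgreeOn]
  | assign x e =>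
    cases c with
    | var y =>
      have : y ≠ x := fun hyx => h (congrArg Cell.var hyx)
      simp [exec, Mem.AgreeOn, Mem.setVar, this]
    | field f => exact fun _ => rfl
  | read x =>
    cases c with
    | var y =>
      have : y ≠ x := fun hyx => h (congrArg Cell.var hyx)
      simp [exec, Mem.AgreeOn, Mem.setVar, this]
    | field f => exact fun _ => rfl
  | fassign x f e =>
    cases c with
    | var y => exact congrFun (Mem.setField_store _ _ _ _) y
    | field g =>
      exact fun l => Mem.setField_heap_of_ne _ _ (fun hgf => h (congrArg Cell.field hgf)) _ l

theorem Mem.AgreeOn.symm {m₁ m₂ : Mem} {c : Cell} (h : m₁.AgreeOn m₂ c) : m₂.AgreeOn m₁ c := by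
  cases c with
  | var x => exact Eq.symm h
  | field f => exact fun l => (h l).symm

theorem Mem.AgreeOn.trans {m₁ m₂ m₃ : Mem} {c : Cell} (h : m₁.AgreeOn m₂ c)
    (h' : m₂.AgreeOn m₃ c) : m₁.AgreeOn m₃ c := by
  cases c with
  | var x => exact Eq.trans h h'
  | field f => exact fun l => (h l).trans (h' l)

theorem Mem.AgreeOn.refl (m : Mem) (c : Cell) : m.AgreeOn m c := by
  cases c <;> simp [AgreeOn]

theorem Comp.Redefines.defines {s : Comp} {c : Cell} (h : s.Redefines c) : s.Defines c := by
  cases s with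
  | guard g => exact h
  | simple a => cases a <;> first | exact h | exact h.elim

/-- Both types have two distinct values. This makes the receiver of a field update a genuine
dependency, so that matching updates hit the same object. -/
theorem semDep_var (x : Var) : SemDep (.var x) fun m => m.store x := by
  obtain ⟨v, w, hvw⟩ : ∃ v w : x.ty.Val, v ≠ w := by
    obtain ⟨t, n⟩ := x
    cases t with
    | int => exact ⟨(0 : ℤ), (1 : ℤ), Int.zero_ne_one⟩
    | ref => exact ⟨(none : Option ℕ), some 0, Option.some_ne_none 0 |>.symm⟩
  let m : Mem := ⟨fun y => y.ty.default, fun _ f => f.ty.default⟩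
  refine ⟨m.setVar x v, m.setVar x w, ⟨fun y hy => ?_, fun _ _ _ => rfl⟩, ?_⟩
  · have : y ≠ x := fun h => hy (h ▸ rfl)
    simp [Mem.setVar, this]
  · simpa [Mem.setVar] using hvw

/-- If two memories agree on everything on which a simple statement depends, then after its
execution they agree on a cell `c`, provided that they agreed on `c` before or that `c` is
redefined. -/
theorem Simple.exec_congr (inp : Mem) {m₁ m₂ : Mem} {a : Simple} {c : Cell}
    (hdep : ∀ d, (Comp.simple a).DependsOn d → m₁.AgreeOn m₂ d)
    (hc : ¬ (Comp.simple a).Redefines c → m₁.AgreeOn m₂ c) :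
    (a.exec inp m₁).AgreeOn (a.exec inp m₂) c := by
  by_cases hr : (Comp.simple a).Redefines c
  · cases a with
    | skip => exact hr.elim
    | write xs => exact hr.elim
    | fassign x f e => exact hr.elim
    | assign x e =>
      obtain rfl : c = .var x := hr
      simpa [exec, Mem.AgreeOn, Mem.setVar] using Exp.eval_congr hdep
    | read x =>
      obtain rfl : c = .var x := hr
      simp [exec, Mem.AgreeOn, Mem.setVar]
  · by_cases hd : (Comp.simple a).Defines c
    · cases a with
      | skip => exact hd.elim
      | write xs => exact hd.elim
      | assign x e => exact (hr hd).elim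
      | read x => exact (hr hd).elim
      -- A field is defined but not redefined here, so `hc` still provides the prior agreement
      -- needed for the other objects.
      | fassign x f e =>
        have hx : m₁.store ⟨.ref, x⟩ = m₂.store ⟨.ref, x⟩ :=
          hdep (.var ⟨.ref, x⟩) (.inl (semDep_var ⟨.ref, x⟩))
        have he : e.eval m₁ = e.eval m₂ := Exp.eval_congr fun d h => hdep d (.inr h)
        simp only [exec, hx, he]
        exact (hc hr).setField _ _ _
    · exact (exec_agreeOn inp m₁ hd).trans ((hc hr).trans (exec_agreeOn inp m₂ hd).symm)

/-! ## Structure of programs -/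

namespace Prog

theorem lines_append (P Q : Prog) : (P.append Q).lines = P.lines ∪ Q.lines := by
  induction P with
  | nil => simp [append, lines]
  | simple n a r ih => simp only [append, lines, ih, Set.union_assoc]
  | ite n g c₁ c₂ r _ _ ih => simp only [append, lines, ih, Set.union_assoc]
  | loop n g c r _ ih => simp only [append, lines, ih, Set.union_assoc]

theorem nested_append (P Q : Prog) (u v : ℕ) :
    (P.append Q).Nested u v ↔ P.Nested u v ∨ Q.Nested u v := by
  induction P with
  | nil => simp [append, Nested]
  | simple n a r ih => simp only [append, Nested, ih]
  | ite n g c₁ c₂ r _ _ ih => simp only [append, Nested, ih, or_assoc]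
  | loop n g c r _ ih => simp only [append, Nested, ih, or_assoc]

/-- Entering a branch or unrolling a loop appends programs, so restriction has to commute with this.
-/
theorem restrict_append (S : Set ℕ) (P Q : Prog) :
    (P.append Q).restrict S = (P.restrict S).append (Q.restrict S) := by
  induction P with
  | nil => rfl
  | simple n a r ih => by_cases h : n ∈ S <;> simp [append, restrict, h, ih]
  | ite n g c₁ c₂ r _ _ ih => by_cases h : n ∈ S <;> simp [append, restrict, h, ih]
  | loop n g c r _ ih => by_cases h : n ∈ S <;> simp [append, restrict, h, ih]

theorem restrict_sub (S : Set ℕ) (P : Prog) : (P.restrict S).Sub P := by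
  induction P with
  | nil => exact .nil
  | simple n a r ih =>
    by_cases h : n ∈ S <;> simp only [restrict, h, if_true, if_false]
    exacts [.simple ih, .dropSimple ih]
  | ite n g c₁ c₂ r ih₁ ih₂ ih =>
    by_cases h : n ∈ S <;> simp only [restrict, h, if_true, if_false]
    exacts [.ite ih₁ ih₂ ih, .dropIte ih]
  | loop n g c r ih₁ ih =>
    by_cases h : n ∈ S <;> simp only [restrict, h, if_true, if_false]
    exacts [.loop ih₁ ih, .dropLoop ih]

theorem restrict_eq_nil {S : Set ℕ} {P : Prog} (h : ∀ v ∈ P.topLines, v ∉ S) :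
    P.restrict S = nil := by
  induction P with
  | nil => rfl
  | simple n a r ih =>
    simp only [restrict, h n (.inl rfl), if_false, ih fun v hv => h v (.inr hv)]
  | ite n g c₁ c₂ r _ _ ih =>
    simp only [restrict, h n (.inl rfl), if_false, ih fun v hv => h v (.inr hv)]
  | loop n g c r _ ih =>
    simp only [restrict, h n (.inl rfl), if_false, ih fun v hv => h v (.inr hv)]

/-- The lines of the restriction to a set that contains, with a statement, the control predicate
within which it is nested. -/
theorem lines_restrict {S : Set ℕ} {P : Prog} (h : ∀ u v, P.Nested u v → v ∈ S → u ∈ S) :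
    (P.restrict S).lines = P.lines ∩ S := by
  induction P with
  | nil => simp [restrict, lines]
  | simple n a r ih =>
    have ih := ih h
    by_cases hn : n ∈ S <;> simp [restrict, lines, hn, ih, Set.insert_inter_of_mem,
      Set.insert_inter_of_notMem]
  | ite n g c₁ c₂ r ih₁ ih₂ ih =>
    have ih₁ := ih₁ fun u v k => h u v (.inr (.inl k))
    have ih₂ := ih₂ fun u v k => h u v (.inr (.inr (.inl k)))
    have ih := ih fun u v k => h u v (.inr (.inr (.inr k)))
    by_cases hn : n ∈ S
    · simp only [restrict, hn, if_true, lines, ih₁, ih₂, ih, Set.union_inter_distrib_right,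
        Set.inter_eq_left.2 (Set.singleton_subset_iff.2 hn)]
    -- The hypothesis `ih₁` becomes `∅ = c₁.lines ∩ S`: removing the branch loses no line of `S`, at
    -- any nesting depth.
    · rw [restrict_eq_nil fun v hv hS => hn (h n v (.inl ⟨rfl, .inl hv⟩) hS), lines] at ih₁
      rw [restrict_eq_nil fun v hv hS => hn (h n v (.inl ⟨rfl, .inr hv⟩) hS), lines] at ih₂
      simp only [restrict, hn, if_false, lines, ih, Set.union_inter_distrib_right, ← ih₁, ← ih₂,
        Set.singleton_inter_eq_empty.2 hn, Set.empty_union]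
  | loop n g c r ih₁ ih =>
    have ih₁ := ih₁ fun u v k => h u v (.inr (.inl k))
    have ih := ih fun u v k => h u v (.inr (.inr k))
    by_cases hn : n ∈ S
    · simp only [restrict, hn, if_true, lines, ih₁, ih, Set.union_inter_distrib_right,
        Set.inter_eq_left.2 (Set.singleton_subset_iff.2 hn)]
    · rw [restrict_eq_nil fun v hv hS => hn (h n v (.inl ⟨rfl, hv⟩) hS), lines] at ih₁
      simp only [restrict, hn, if_false, lines, ih, Set.union_inter_distrib_right, ← ih₁,
        Set.singleton_inter_eq_empty.2 hn, Set.empty_union]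

theorem Nested.mem_lines {P : Prog} {u v : ℕ} (h : P.Nested u v) : u ∈ P.lines := by
  induction P with
  | nil => exact h.elim
  | simple n a r ih => exact .inr (ih h)
  | ite n g c₁ c₂ r ih₁ ih₂ ih =>
    rcases h with ⟨rfl, -⟩ | h | h | h
    exacts [.inl (.inl (.inl rfl)), .inl (.inl (.inr (ih₁ h))), .inl (.inr (ih₂ h)), .inr (ih h)]
  | loop n g c r ih₁ ih =>
    rcases h with ⟨rfl, -⟩ | h | h
    exacts [.inl (.inl rfl), .inl (.inr (ih₁ h)), .inr (ih h)]

theorem head?_mem_lines {K : Prog} {u : ℕ} {s : Comp} (h : K.head? = some (u, s)) :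
    u ∈ K.lines := by
  cases K <;> simp_all [head?, lines]

theorem Ctl.lines_subset {K K' : Prog} (h : Ctl K K') : K'.lines ⊆ K.lines := by
  intro x hx
  cases h <;> simp only [lines_append, lines, Set.mem_union, Set.mem_singleton_iff] at hx ⊢ <;>
    tauto

theorem Ctl.nested {K K' : Prog} (h : Ctl K K') {u v : ℕ} (hx : K'.Nested u v) :
    K.Nested u v := by
  cases h <;> simp only [nested_append, Nested] at hx ⊢ <;> tauto

theorem lines_subset_of_reflTransGen {P K : Prog} (h : Relation.ReflTransGen Ctl P K) :
    K.lines ⊆ P.lines := by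
  induction h with
  | refl => exact subset_rfl
  | tail _ h ih => exact h.lines_subset.trans ih

/-! ### Relevant cells and dependency-closed sets -/

/-- The cell `c` is relevant when control is at `K`: its value may be used or observed at a line
in `S` before `c` is redefined. -/
def Relevant (C : Criterion) (S : Set ℕ) (K : Prog) (c : Cell) : Prop :=
  ∃ K₂ v s, Relation.ReflTransGen (CtlKeeping c) K K₂ ∧ K₂.head? = some (v, s) ∧ v ∈ S ∧
    (s.DependsOn c ∨ C.Observes v c)

theorem Relevant.of_step {C : Criterion} {S : Set ℕ} {K K' : Prog} {c : Cell} {n : ℕ} {s : Comp}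
    (h : Relevant C S K' c) (hstep : Ctl K K') (hK : K.head? = some (n, s))
    (hc : ¬ s.Redefines c) : Relevant C S K c := by
  obtain ⟨K₂, v, t, hpath, hrest⟩ := h
  refine ⟨K₂, v, t, .head ⟨hstep, fun n' s' h' => ?_⟩ hpath, hrest⟩
  obtain ⟨-, rfl⟩ := Prod.ext_iff.1 (Option.some.inj (hK.symm.trans h'))
  exact hc

/-- What a dependency-closed set of lines of `P` satisfies: it consists of lines of `P`, contains
the lines of the criterion, and is closed under predecessors in the semantic dependence graph. -/
structure SliceClosed (C : Criterion) (P : Prog) (S : Set ℕ) : Prop where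
  points : ∀ n ∈ P.lines, n ∈ C.points → n ∈ S
  nested : ∀ u v, P.Nested u v → v ∈ S → u ∈ S
  flow : ∀ u v, P.SemFlow C u v → v ∈ S → u ∈ S

/-- A step of control creates no new lines, nesting or control paths, so closedness passes to the
residual program. This lets the simulation induct along a run. -/
theorem SliceClosed.mono {C : Criterion} {P K : Prog} {S : Set ℕ} (h : SliceClosed C P S)
    (hK : Ctl P K) : SliceClosed C K S where
  points n hn := h.points n (hK.lines_subset hn)
  nested u v huv := h.nested u v (hK.nested huv)
  flow := fun u v ⟨c, K', K₁, K₂, su, sv, hreach, hrest⟩ =>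
    h.flow u v ⟨c, K', K₁, K₂, su, sv, .head hK hreach, hrest⟩

/-- After a step at a line outside a closed set, no cell defined at that line is relevant. -/
theorem SliceClosed.not_relevant {C : Criterion} {K K' : Prog} {S : Set ℕ}
    (h : SliceClosed C K S) {n : ℕ} {s : Comp} (hhead : K.head? = some (n, s)) (hn : n ∉ S)
    (hstep : Ctl K K') {c : Cell} (hc : s.Defines c) : ¬ Relevant C S K' c := by
  rintro ⟨K₂, v, sv, hpath, hv, hvS, hdep⟩
  exact hn (h.flow n v ⟨c, K, K', K₂, s, sv, .refl, hhead, hc, hstep, hpath, hv, hdep⟩ hvS)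

end Prog

theorem sliceLines_closed (C : Criterion) (P : Prog) : P.SliceClosed C (sliceLines C P) where
  points n hn hC := ⟨hn, n, hC, .refl⟩
  nested := fun _ _ huv ⟨_, n, hn, hpath⟩ => ⟨huv.mem_lines, n, hn, .head (.control huv) hpath⟩
  flow := by
    rintro u v huv ⟨-, n, hn, hpath⟩
    refine ⟨?_, n, hn, .head (.flow huv) hpath⟩
    obtain ⟨c, K, K₁, K₂, su, sv, hreach, hhead, -⟩ := huv
    exact Prog.lines_subset_of_reflTransGen hreach (Prog.head?_mem_lines hhead)

/-! ## The simulation -/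

/-- The traces `t` and `t'` have the same projection, whatever the numbers of earlier executions
are, as long as these coincide on `S`. -/
def ProjEq (C : Criterion) (S L : Set ℕ) (t t' : List (ℕ × Mem)) : Prop :=
  ∀ k k' : ℕ → ℕ, (∀ n ∈ S, k n = k' n) →
    proj C.vars C.occs L (count k t) = proj C.vars C.occs L (count k' t')

/-- The state is erased by the projection, and only a counter outside `S` advances. -/
theorem ProjEq.skip {C : Criterion} {S L : Set ℕ} (hL : L ⊆ S) {n : ℕ} (hn : n ∉ S)
    (hC : n ∉ C.points) {t t' : List (ℕ × Mem)} (h : ProjEq C S L t t') (m : Mem) :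
    ProjEq C S L ((n, m) :: t) t' := by
  intro k k' hk
  have hnone : projState C.vars C.occs L ⟨n, k n + 1, m⟩ = none := by
    rw [projState, if_neg, if_neg fun h => hn (hL h)]
    exact fun ⟨K, hK, _⟩ => hC ⟨K, hK⟩
  simp only [count, proj, List.filterMap_cons, hnone]
  refine h _ k' fun j hj => ?_
  have hjn : j ≠ n := fun h => hn (h ▸ hj)
  rw [Function.update_of_ne hjn, hk j hj]

theorem ProjEq.cons {C : Criterion} {S L : Set ℕ} {n : ℕ} (hn : n ∈ S) {m m' : Mem}
    (hm : n ∈ C.points → ∀ x ∈ C.vars, m.store x = m'.store x) {t t' : List (ℕ × Mem)}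
    (h : ProjEq C S L t t') : ProjEq C S L ((n, m) :: t) ((n, m') :: t') := by
  intro k k' hk
  have hstate : projState C.vars C.occs L ⟨n, k n + 1, m⟩ =
      projState C.vars C.occs L ⟨n, k' n + 1, m'⟩ := by
    rw [← hk n hn]
    unfold projState
    split_ifs with hO
    · have hobs : (fun x : C.vars => m.store x.1) = fun x : C.vars => m'.store x.1 :=
        funext fun x => hm (hO.imp fun _ h => h.1) x.1 x.2
      simp only [hobs]
    all_goals rfl
  have htail := h (Function.update k n (k n + 1)) (Function.update k' n (k' n + 1)) fun j hj => by
    by_cases hjn : j = n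
    · subst hjn; simp [hk j hj]
    · simp [hjn, hk j hj]
  simp only [proj] at htail
  simp only [count, proj, List.filterMap_cons, hstate, htail]

open Prog in
/-- Every finite part of the execution of a program is simulated by the restriction of the program
to a closed set of lines, from any memory that agrees on the relevant cells. -/
theorem Run.restrict {C : Criterion} {S L : Set ℕ} (hL : L ⊆ S) {inp : Mem} {K R : Prog}
    {m m₁ : Mem} {t : List (ℕ × Mem)} (hrun : Run inp K m t R m₁) (hS : SliceClosed C K S)
    {μ : Mem} (hμ : ∀ c, Relevant C S K c → m.AgreeOn μ c) :
    ∃ t' μ₁, Run inp (K.restrict S) μ t' (R.restrict S) μ₁ ∧ ProjEq C S L t t' := by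
  have obs : ∀ {K : Prog} {m μ : Mem}, (∀ c, Relevant C S K c → m.AgreeOn μ c) →
      ∀ {n s}, K.head? = some (n, s) → n ∈ S →
        n ∈ C.points → ∀ x ∈ C.vars, m.store x = μ.store x := fun hμ n s hhead hn hC x hx =>
    hμ (.var x) ⟨_, n, s, .refl, hhead, hn, .inr ⟨hC, x, hx, rfl⟩⟩
  have dep : ∀ {K : Prog} {m μ : Mem}, (∀ c, Relevant C S K c → m.AgreeOn μ c) →
      ∀ {n s}, K.head? = some (n, s) → n ∈ S → ∀ c, s.DependsOn c → m.AgreeOn μ c :=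
    fun hμ n s hhead hn c hc => hμ c ⟨_, n, s, .refl, hhead, hn, .inl hc⟩
  induction hrun generalizing μ with
  | refl K m =>
    refine ⟨[], μ, .refl _ _, fun k k' _ => rfl⟩
  | @simple n a r m t R m₁ _ ih =>
    have hstep : Ctl (.simple n a r) r := .simple
    have ih := fun {ν} => ih (hS.mono hstep) (μ := ν)
    by_cases hn : n ∈ S
    · obtain ⟨t', μ₁, hrun, hproj⟩ := ih (ν := a.exec inp μ) fun c hc =>
        Simple.exec_congr inp (dep hμ rfl hn) fun hr => hμ c (hc.of_step hstep rfl hr)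
      refine ⟨(n, μ) :: t', μ₁, ?_, hproj.cons hn (obs hμ rfl hn)⟩
      simp only [Prog.restrict, hn, if_true]
      exact .simple hrun
    -- The slice does not move here: a cell relevant afterwards is not defined at `n`, so its value
    -- and its relevance both go back to before the step.
    · obtain ⟨t', μ₁, hrun, hproj⟩ := ih (ν := μ) fun c hc => by
        have hd : ¬ (Comp.simple a).Defines c := fun hd =>
          hS.not_relevant rfl hn hstep hd hc
        exact (a.exec_agreeOn inp m hd).trans
          (hμ c (hc.of_step hstep rfl fun hr => hd hr.defines))
      refine ⟨t', μ₁, ?_, hproj.skip hL hn (fun h => hn (hS.points n (.inl rfl) h)) m⟩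
      simpa only [Prog.restrict, hn, if_false] using hrun
  | @ite n g c₁ c₂ r m t R m₁ _ ih =>
    have hstep : Ctl (.ite n g c₁ c₂ r) ((if g.eval m then c₁ else c₂).append r) := by
      split_ifs
      exacts [.iteTrue, .iteFalse]
    obtain ⟨t', μ₁, hrun, hproj⟩ := ih (hS.mono hstep) (μ := μ) fun c hc =>
      -- `id` works because a guard redefines nothing.
      hμ c (hc.of_step hstep rfl id)
    rw [restrict_append] at hrun
    by_cases hn : n ∈ S
    · have hg : g.eval m = g.eval μ := Guard.eval_congr (dep hμ rfl hn)
      refine ⟨(n, μ) :: t', μ₁, ?_, hproj.cons hn (obs hμ rfl hn)⟩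
      simp only [Prog.restrict, hn, if_true]
      refine .ite ?_
      rw [← hg]
      split_ifs at hrun ⊢ <;> exact hrun
    · refine ⟨t', μ₁, ?_, hproj.skip hL hn (fun h => hn (hS.points n (.inl (.inl (.inl rfl))) h)) m⟩
      have hnil : (if g.eval m then c₁ else c₂).restrict S = nil := by
        refine restrict_eq_nil fun v hv hvS => hn (hS.nested n v (.inl ⟨rfl, ?_⟩) hvS)
        split_ifs at hv
        exacts [.inl hv, .inr hv]
      rw [hnil] at hrun
      simpa only [append, Prog.restrict, hn, if_false] using hrun
  | @loop n g c r m t R m₁ _ ih =>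
    have hstep : Ctl (.loop n g c r) (if g.eval m then c.append (.loop n g c r) else r) := by
      split_ifs
      exacts [.loopTrue, .loopFalse]
    obtain ⟨t', μ₁, hrun, hproj⟩ := ih (hS.mono hstep) (μ := μ) fun c hc =>
      hμ c (hc.of_step hstep rfl id)
    by_cases hn : n ∈ S
    · have hg : g.eval m = g.eval μ := Guard.eval_congr (dep hμ rfl hn)
      refine ⟨(n, μ) :: t', μ₁, ?_, hproj.cons hn (obs hμ rfl hn)⟩
      simp only [Prog.restrict, hn, if_true]
      refine .loop ?_
      rw [← hg]
      split_ifs at hrun ⊢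
      · simpa only [restrict_append, Prog.restrict, hn, if_true] using hrun
      · exact hrun
    · refine ⟨t', μ₁, ?_, hproj.skip hL hn (fun h => hn (hS.points n (.inl (.inl rfl)) h)) m⟩
      simp only [Prog.restrict, hn, if_false]
      split_ifs at hrun
      -- An iteration of a dropped loop restricts to the empty program followed by the restriction
      -- of what comes after the loop.
      · have hnil : c.restrict S = nil :=
          restrict_eq_nil fun v hv hvS => hn (hS.nested n v (.inl ⟨rfl, hv⟩) hvS)
        simpa only [restrict_append, hnil, append, Prog.restrict, hn, if_false] using hrun
      · exact hrun

end Slicing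

theorem mainTheorem3 (C : Criterion) (P : Prog) :
    (P.restrict (sliceLines C P)).lines = sliceLines C P ∧
      IsSlice C P (P.restrict (sliceLines C P)) := by
  have hS := sliceLines_closed C P
  have hlines : (P.restrict (sliceLines C P)).lines = sliceLines C P := by
    rw [Prog.lines_restrict hS.nested]
    exact Set.inter_eq_right.2 fun _ h => h.1
  -- The lines whose order the criterion may track are lines of the slice, so skipped states are
  -- invisible.
  have hL : C.common P (P.restrict (sliceLines C P)) ⊆ sliceLines C P :=
    fun n hn => hlines ▸ hn.2.2
  refine ⟨hlines, Prog.restrict_sub _ P, fun μ _ => ⟨?_, ?_⟩⟩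
  · rintro _ ⟨t, m', hrun, rfl⟩
    -- Halting is preserved because the residual program `nil` restricts to `nil`.
    obtain ⟨t', μ₁, hrun', hproj⟩ := hrun.restrict hL hS fun c _ => Mem.AgreeOn.refl μ c
    exact ⟨_, ⟨t', μ₁, hrun', rfl⟩, hproj _ _ fun _ _ => rfl⟩
  · rintro _ ⟨t, R, m', hrun, rfl⟩
    obtain ⟨t', μ₁, hrun', hproj⟩ := hrun.restrict hL hS fun c _ => Mem.AgreeOn.refl μ c
    exact ⟨_, ⟨t', _, μ₁, hrun', rfl⟩, hproj _ _ fun _ _ => rfl⟩
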